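/- Let $(U_y)_{y\in\mathbb Z}$ and $(V_x)_{x\in\mathbb Z}$ be random variables on a probability space $(\Omega,\mathcal A,\mathbb P)$ with values in $\{-1,1\}$, all independent and with symmetric distribution ($U_y$ and $V_x$ are the random orientations of the horizontal line at height $y$ and of the vertical line at abscissa $x$ of the lattice $\mathbb Z^2$). Let $Z=(Z_i)_{i\ge 0}=((X_i,Y_i))_{i\ge0}$ be the path in $\mathbb Z^2$ defined by $Z_0=(0,0)$ and $$Z_{i+1}=Z_i+(U_{Y_i},V_{X_i})\qquad(i\ge 0),$$ and let $\|\cdot\|$ be the Euclidean norm. Then $\sup_{i\ge0}\|Z_i\|$ is almost surely attained (so that it is a finite maximum), and there exist positive constants $c_1,C_1,c_2,C_2$, which depend neither on $n$ nor on the choice of the probability space and of the variables, such that, for all integers $n\ge 0$, $$C_1e^{-c_1n^{1/3}}\;\le\;\mathbb P\Big(\max_{i\ge0}\|Z_i\|>n\Big)\;\le\;C_2e^{-c_2n^{1/4}}.$$ -/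

import Mathlib

open MeasureTheory ProbabilityTheory
open scoped ENNReal

/-- The environment of the randomly oriented Manhattan lattice of dimension two: `U y` is the
orientation of the horizontal line at height `y` and `V x` the orientation of the vertical line at
abscissa `x`. All these random variables take values in `{-1, 1}`, have a symmetric distribution,
and are independent (the whole family `(U_y)_y, (V_x)_x` jointly). -/
structure IsRandomOrientation {Ω : Type*} [MeasurableSpace Ω] (P : Measure Ω)
    (U V : ℤ → Ω → ℤ) : Prop where
  measurable_U : ∀ y, Measurable (U y)
  measurable_V : ∀ x, Measurable (V x)
  values_U : ∀ y ω, U y ω = 1 ∨ U y ω = -1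
  values_V : ∀ x ω, V x ω = 1 ∨ V x ω = -1
  symm_U : ∀ y, P {ω | U y ω = 1} = P {ω | U y ω = -1}
  symm_V : ∀ x, P {ω | V x ω = 1} = P {ω | V x ω = -1}
  indep : iIndepFun (Sum.elim U V) P

/-- The deterministic path driven by the orientations `u` (horizontal lines) and `v` (vertical
lines): it starts at the origin, and from `(x, y)` it moves to `(x + u y, y + v x)`. -/
def diagonalWalk (u v : ℤ → ℤ) : ℕ → ℤ × ℤ
  | 0 => (0, 0)
  | n + 1 =>
    ((diagonalWalk u v n).1 + u (diagonalWalk u v n).2,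
      (diagonalWalk u v n).2 + v (diagonalWalk u v n).1)

/-- The Euclidean norm of a point of `ℤ²`. -/
noncomputable def latticeNorm (z : ℤ × ℤ) : ℝ :=
  Real.sqrt ((z.1 : ℝ) ^ 2 + (z.2 : ℝ) ^ 2)

/-- The maximal distance to the origin reached by the path, as a supremum in `[0, ∞]`
(it is `∞` exactly when the path is unbounded). -/
noncomputable def maximalDistance (u v : ℤ → ℤ) : ℝ≥0∞ :=
  ⨆ i : ℕ, ENNReal.ofReal (latticeNorm (diagonalWalk u v i))

/-! Everything rests on averaging over the orientation of one line at a time. Reversing a line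
preserves the law of the environment (`map_reverseLine`), so if `F (n + 1) c` and its value after
reversing line `i n` add up to at most `2 * a * F n c`, then the mean of `F n` is at most `a ^ n`
times that of `F 0`. This replaces conditional expectations and martingales.

Upper bound. The path enters a new abscissa x > 0 from x - 1. Suppose that the horizontal line met
there points left (a turn). If the fresh vertical line at x is opposite to the one at x - 1, the
path is trapped on two vertices (`not_reaches_of_turnsAt`). Each turn is thus survived with
probability at most 1/2, and K turns cost 2^(-K) (`real_turns_le`). With fewer than K turns among
K(M+1) new abscissae, some block of M+1 abscissae has none. There the path goes straight right, its
height follows a simple random walk made of vertical orientations, and every horizontal line met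
points right. Either this walk stays in [-L, L] for M steps (`real_confined_le`), or it sweeps L+1
consecutive lines, all pointing right (`real_isRun`). With L = K and M = K^3 the three costs are all
exponentially small in K, at distance of order K^4; hence the exponent 1/4. Reflection and exchange
of the axes handle the other sides of the box.

Lower bound. Make the 2L+1 horizontal lines of a strip point right and confine the vertical walk to
the strip for n steps. The cost is exp(-O(L + n/L^2)), balanced at L of order n^(1/3). -/

/-- The configuration space of the environment: `c (Sum.inl y)` is the orientation of the
horizontal line at height `y`, and `c (Sum.inr x)` that of the vertical line at abscissa `x`. -/
abbrev Environment := ℤ ⊕ ℤ → ℤ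

/-- Reverse the orientation of the line `i`. -/
def reverseLine (i : ℤ ⊕ ℤ) (c : Environment) : Environment := Function.update c i (-(c i))

/-- All orientations are `1` or `-1`. -/
def IsOriented (c : Environment) : Prop := ∀ i, c i = 1 ∨ c i = -1

theorem reverseLine_same (i : ℤ ⊕ ℤ) (c : Environment) : reverseLine i c i = -(c i) := by
  simp [reverseLine]

theorem reverseLine_of_ne {i j : ℤ ⊕ ℤ} (h : j ≠ i) (c : Environment) :
    reverseLine i c j = c j := by
  simp [reverseLine, h]

theorem measurable_reverseLine (i : ℤ ⊕ ℤ) : Measurable (reverseLine i) := by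
  rw [measurable_pi_iff]
  intro j
  by_cases h : j = i
  · subst h
    simp only [reverseLine_same]
    exact (measurable_pi_apply j).neg
  · simp only [reverseLine_of_ne h]
    exact measurable_pi_apply j

/-! ### Invariance of the law and averaging over lines -/

section Law

variable {Ω : Type*} [MeasurableSpace Ω] {P : Measure Ω} {U V : ℤ → Ω → ℤ}

/-- The random environment, as a random element of the configuration space. -/
def environment (U V : ℤ → Ω → ℤ) (ω : Ω) : Environment := fun i => Sum.elim U V i ω

theorem IsRandomOrientation.measurable_apply (h : IsRandomOrientation P U V) (i : ℤ ⊕ ℤ) :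
    Measurable (Sum.elim U V i) := by
  cases i with
  | inl y => exact h.measurable_U y
  | inr x => exact h.measurable_V x

theorem IsRandomOrientation.measurable_environment (h : IsRandomOrientation P U V) :
    Measurable (environment U V) :=
  measurable_pi_iff.2 h.measurable_apply

theorem IsRandomOrientation.isOriented (h : IsRandomOrientation P U V) (ω : Ω) :
    IsOriented (environment U V ω) := by
  intro i
  cases i with
  | inl y => exact h.values_U y ω
  | inr x => exact h.values_V x ω

theorem map_neg_eq_of_symm {f : Ω → ℤ} (hf : Measurable f)
    (hv : ∀ ω, f ω = 1 ∨ f ω = -1) (hs : P {ω | f ω = 1} = P {ω | f ω = -1}) :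
    P.map (fun ω => -(f ω)) = P.map f := by
  have hn : Measurable fun ω => -(f ω) := hf.neg
  refine Measure.ext_of_singleton fun a => ?_
  rw [Measure.map_apply hn (measurableSet_singleton a),
    Measure.map_apply hf (measurableSet_singleton a)]
  have e1 : (fun ω => -(f ω)) ⁻¹' {a} = {ω | f ω = -a} := by
    ext ω; simp only [Set.mem_preimage, Set.mem_singleton_iff, Set.mem_ofPred_eq]; omega
  have e2 : f ⁻¹' {a} = {ω | f ω = a} := rfl
  rw [e1, e2]
  by_cases h1 : a = 1
  · subst h1; exact hs.symm
  by_cases h2 : a = -1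
  · subst h2; simpa using hs
  have e3 : {ω | f ω = -a} = ∅ := by
    ext ω; simp only [Set.mem_ofPred_eq, Set.mem_empty_iff_false, iff_false]
    rcases hv ω with h | h <;> omega
  have e4 : {ω | f ω = a} = ∅ := by
    ext ω; simp only [Set.mem_ofPred_eq, Set.mem_empty_iff_false, iff_false]
    rcases hv ω with h | h <;> omega
  rw [e3, e4]

/-- The law of the environment is invariant under the reversal of one line. -/
theorem IsRandomOrientation.map_reverseLine [IsProbabilityMeasure P]
    (h : IsRandomOrientation P U V) (i : ℤ ⊕ ℤ) :
    P.map (fun ω => reverseLine i (environment U V ω)) = P.map (environment U V) := by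
  classical
  let g : ℤ ⊕ ℤ → ℤ → ℤ := fun j a => if j = i then -a else a
  have hg : ∀ j, Measurable (g j) := fun j => measurable_from_top
  have h1 := h.indep.comp g hg
  have e1 := h1.map_fun_eq_infinitePi_map fun j => (hg j).comp (h.measurable_apply j)
  have e2 := h.indep.map_fun_eq_infinitePi_map h.measurable_apply
  have e3 : (fun ω => reverseLine i (environment U V ω)) =
      fun ω j => (g j ∘ Sum.elim U V j) ω := by
    funext ω j
    by_cases hj : j = i
    · subst hj; simp [reverseLine_same, g, environment]
    · simp [reverseLine_of_ne hj, g, environment, hj]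
  have e4 : ∀ j, P.map (g j ∘ Sum.elim U V j) = P.map (Sum.elim U V j) := by
    intro j
    by_cases hj : j = i
    · have : g j ∘ Sum.elim U V j = fun ω => -(Sum.elim U V j ω) := by
        funext ω; simp [g, hj]
      rw [this]
      cases j with
      | inl y => exact map_neg_eq_of_symm (h.measurable_U y) (h.values_U y) (h.symm_U y)
      | inr x => exact map_neg_eq_of_symm (h.measurable_V x) (h.values_V x) (h.symm_V x)
    · have : g j ∘ Sum.elim U V j = Sum.elim U V j := by
        funext ω; simp [g, hj]
      rw [this]
  rw [e3, e1]
  simp only [e4]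
  exact e2.symm

theorem IsRandomOrientation.integrable [IsProbabilityMeasure P] (h : IsRandomOrientation P U V)
    {F : Environment → ℝ} (hF : Measurable F) {B : ℝ} (hB : ∀ c, |F c| ≤ B) :
    Integrable (fun ω => F (environment U V ω)) P :=
  Integrable.of_bound (hF.comp h.measurable_environment).aestronglyMeasurable B
    (Filter.Eventually.of_forall fun _ => hB _)

/-- One step of averaging over the orientation of a single line. -/
theorem IsRandomOrientation.integral_le_of_reverseLine [IsProbabilityMeasure P]
    (h : IsRandomOrientation P U V) (i : ℤ ⊕ ℤ) {F G : Environment → ℝ}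
    (hF : Measurable F) (hG : Measurable G) {A B : ℝ} (hA : ∀ c, |F c| ≤ A)
    (hB : ∀ c, |G c| ≤ B) (a : ℝ)
    (hle : ∀ c, IsOriented c → G c + G (reverseLine i c) ≤ 2 * a * F c) :
    ∫ ω, G (environment U V ω) ∂P ≤ a * ∫ ω, F (environment U V ω) ∂P := by
  have hr := measurable_reverseLine i
  have e : ∫ ω, G (reverseLine i (environment U V ω)) ∂P = ∫ ω, G (environment U V ω) ∂P := by
    have h1 := integral_map (μ := P) (hr.comp h.measurable_environment).aemeasurable
      (f := G) hG.aestronglyMeasurable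
    have h2 := integral_map (μ := P) h.measurable_environment.aemeasurable
      (f := G) hG.aestronglyMeasurable
    have h3 := h.map_reverseLine i
    simp only [Function.comp_def] at h1
    rw [← h1, ← h2, h3]
  have i1 := h.integrable hG hB
  have i2 := h.integrable (F := fun c => G (reverseLine i c)) (hG.comp hr) fun c => hB _
  have i3 := h.integrable hF hA
  have key : ∫ ω, (G (environment U V ω) + G (reverseLine i (environment U V ω))) ∂P ≤
      ∫ ω, 2 * a * F (environment U V ω) ∂P :=
    integral_mono (i1.add i2) (i3.const_mul _) fun ω => hle _ (h.isOriented ω)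
  rw [integral_add i1 i2, e, integral_const_mul] at key
  linarith

/-- A supermartingale estimate without filtrations: half the sum over the two orientations of line
`i n` plays the role of a conditional expectation given all other lines. -/
theorem IsRandomOrientation.integral_le_pow_of_reverseLine [IsProbabilityMeasure P]
    (h : IsRandomOrientation P U V) (i : ℕ → ℤ ⊕ ℤ) {F : ℕ → Environment → ℝ}
    (hF : ∀ n, Measurable (F n)) {A : ℕ → ℝ} (hA : ∀ n c, |F n c| ≤ A n) {a : ℝ} (ha : 0 ≤ a)
    (hle : ∀ n c, IsOriented c → F (n + 1) c + F (n + 1) (reverseLine (i n) c) ≤ 2 * a * F n c)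
    (n : ℕ) :
    ∫ ω, F n (environment U V ω) ∂P ≤ a ^ n * ∫ ω, F 0 (environment U V ω) ∂P := by
  induction n with
  | zero => simp
  | succ n ih =>
    refine (h.integral_le_of_reverseLine (i n) (hF n) (hF (n + 1)) (hA n) (hA (n + 1)) a
      (hle n)).trans ?_
    rw [pow_succ']
    nlinarith [mul_le_mul_of_nonneg_left ih ha]

theorem IsRandomOrientation.pow_le_integral_of_reverseLine [IsProbabilityMeasure P]
    (h : IsRandomOrientation P U V) (i : ℕ → ℤ ⊕ ℤ) {F : ℕ → Environment → ℝ}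
    (hF : ∀ n, Measurable (F n)) {A : ℕ → ℝ} (hA : ∀ n c, |F n c| ≤ A n) {a : ℝ} (ha : 0 ≤ a)
    (hle : ∀ n c, IsOriented c → 2 * a * F n c ≤ F (n + 1) c + F (n + 1) (reverseLine (i n) c))
    (n : ℕ) :
    a ^ n * ∫ ω, F 0 (environment U V ω) ∂P ≤ ∫ ω, F n (environment U V ω) ∂P := by
  have := h.integral_le_pow_of_reverseLine i (F := fun n c => -F n c) (fun n => (hF n).neg)
    (A := A) (fun n c => by simpa using hA n c) ha
    (fun n c hc => by have := hle n c hc; linarith) n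
  simp only [integral_neg] at this
  linarith

/-- The environment reflected with respect to the vertical axis. -/
theorem IsRandomOrientation.reflect (h : IsRandomOrientation P U V) :
    IsRandomOrientation P (fun y ω => -(U y ω)) (fun x => V (-x)) where
  measurable_U y := (h.measurable_U y).neg
  measurable_V x := h.measurable_V _
  values_U y ω := by rcases h.values_U y ω with h | h <;> simp [h]
  values_V x ω := h.values_V _ ω
  symm_U y := by
    have := h.symm_U y
    simpa [neg_eq_iff_eq_neg] using this.symm
  symm_V x := h.symm_V _
  indep := by
    have h1 := h.indep.precomp (g := Sum.map id Neg.neg)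
      (Sum.map_injective.2 ⟨Function.injective_id, neg_injective⟩)
    have h2 := h1.comp (fun i => (Sum.elim (fun _ a => -a) (fun _ a => a) i : ℤ → ℤ))
      (fun i => measurable_from_top)
    convert h2 using 1
    funext i
    cases i <;> rfl

/-- The roles of the horizontal and the vertical lines exchanged. -/
theorem IsRandomOrientation.swap (h : IsRandomOrientation P U V) :
    IsRandomOrientation P V U where
  measurable_U := h.measurable_V
  measurable_V := h.measurable_U
  values_U := h.values_V
  values_V := h.values_U
  symm_U := h.symm_V
  symm_V := h.symm_U
  indep := by
    have h1 := h.indep.precomp (g := Sum.swap) Sum.swap_leftInverse.injective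
    convert h1 using 1
    funext i
    cases i <;> rfl

end Law

/-! ### Partial sums, confinement and runs -/

/-- The displacement along `k` consecutive vertical lines, from the abscissa `x` on. -/
def partialSum (c : Environment) (x : ℤ) (k : ℕ) : ℤ :=
  ∑ l ∈ Finset.range k, c (Sum.inr (x + l))

/-- The partial sums stay in `[-L, L]` up to time `k`. -/
def Confined (L : ℕ) (x : ℤ) (k : ℕ) (c : Environment) : Prop :=
  ∀ i ≤ k, |partialSum c x i| ≤ L

/-- The `j` horizontal lines from the height `y` on are all oriented to the right. -/
def IsRun (y : ℤ) (j : ℕ) (c : Environment) : Prop :=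
  ∀ i < j, c (Sum.inl (y + (i : ℕ))) = 1

theorem measurable_partialSum (x : ℤ) (k : ℕ) : Measurable fun c => partialSum c x k :=
  Finset.measurable_fun_sum _ fun _ _ => measurable_pi_apply _

theorem measurableSet_confined (L : ℕ) (x : ℤ) (k : ℕ) : MeasurableSet {c | Confined L x k c} := by
  have : {c | Confined L x k c} =
      ⋂ i : ℕ, ⋂ _ : i ≤ k, (fun c => partialSum c x i) ⁻¹' {t | |t| ≤ (L : ℤ)} := by
    ext c; simp [Confined]
  rw [this]
  exact MeasurableSet.iInter fun i => MeasurableSet.iInter fun _ =>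
    measurable_partialSum x i (Set.to_countable _).measurableSet

theorem measurableSet_isRun (y : ℤ) (j : ℕ) : MeasurableSet {c | IsRun y j c} := by
  have : {c | IsRun y j c} =
      ⋂ i : ℕ, ⋂ _ : i < j, (fun c : Environment => c (Sum.inl (y + (i : ℕ)))) ⁻¹' {1} := by
    ext c; simp [IsRun]
  rw [this]
  exact MeasurableSet.iInter fun i => MeasurableSet.iInter fun _ =>
    measurable_pi_apply _ (measurableSet_singleton _)

theorem partialSum_reverseLine (c : Environment) (x : ℤ) {j k : ℕ} (h : j ≤ k) :
    partialSum (reverseLine (Sum.inr (x + k)) c) x j = partialSum c x j := by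
  refine Finset.sum_congr rfl fun l hl => reverseLine_of_ne ?_ c
  have := Finset.mem_range.1 hl
  simp only [ne_eq, Sum.inr.injEq, add_right_inj, Nat.cast_inj]
  omega

theorem partialSum_succ (c : Environment) (x : ℤ) (k : ℕ) :
    partialSum c x (k + 1) = partialSum c x k + c (Sum.inr (x + k)) :=
  Finset.sum_range_succ _ _

theorem partialSum_succ_reverseLine (c : Environment) (x : ℤ) (k : ℕ) :
    partialSum (reverseLine (Sum.inr (x + k)) c) x (k + 1) =
      partialSum c x k - c (Sum.inr (x + k)) := by
  rw [partialSum_succ, partialSum_reverseLine c x le_rfl, reverseLine_same, sub_eq_add_neg]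

theorem confined_succ {L : ℕ} {x : ℤ} {k : ℕ} {c : Environment} :
    Confined L x (k + 1) c ↔ Confined L x k c ∧ |partialSum c x (k + 1)| ≤ L := by
  constructor
  · exact fun h => ⟨fun i hi => h i (by omega), h _ le_rfl⟩
  · rintro ⟨h, h'⟩ i hi
    rcases Nat.lt_or_ge i (k + 1) with hk | hk
    · exact h i (by omega)
    · rwa [show i = k + 1 by omega]

theorem confined_reverseLine {L : ℕ} {x : ℤ} {k : ℕ} {c : Environment} :
    Confined L x k (reverseLine (Sum.inr (x + k)) c) ↔ Confined L x k c := by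
  refine forall₂_congr fun i hi => ?_
  rw [partialSum_reverseLine c x hi]

open Classical in
/-- The cosine of the partial sum, killed when the partial sums leave `[-L, L]`. -/
noncomputable def killedCos (θ : ℝ) (L : ℕ) (x : ℤ) (k : ℕ) (c : Environment) : ℝ :=
  if Confined L x k c then Real.cos (θ * partialSum c x k) else 0

theorem measurable_killedCos (θ : ℝ) (L : ℕ) (x : ℤ) (k : ℕ) :
    Measurable (killedCos θ L x k) := by
  refine Measurable.ite (measurableSet_confined L x k) ?_ measurable_const
  exact (measurable_from_top (f := fun t : ℤ => Real.cos (θ * t))).comp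
    (measurable_partialSum x k)

theorem abs_killedCos_le (θ : ℝ) (L : ℕ) (x : ℤ) (k : ℕ) (c : Environment) :
    |killedCos θ L x k c| ≤ 1 := by
  unfold killedCos
  split_ifs
  · exact Real.abs_cos_le_one _
  · simp

theorem killedCos_succ (θ : ℝ) {L : ℕ} {x : ℤ} {k : ℕ} {c : Environment}
    (h : Confined L x k c) :
    killedCos θ L x (k + 1) c = if |partialSum c x (k + 1)| ≤ (L : ℤ) then
      Real.cos (θ * partialSum c x (k + 1)) else 0 := by
  simp [killedCos, confined_succ, h]

theorem killedCos_of_not {θ : ℝ} {L : ℕ} {x : ℤ} {k : ℕ} {c : Environment}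
    (h : ¬ Confined L x k c) : killedCos θ L x k c = 0 := by
  simp [killedCos, h]

/-- Cosines are eigenfunctions of the simple random walk, with eigenvalue `cos θ`. -/
theorem cos_add_cos_sub_of_sign (θ : ℝ) (t e : ℤ) (he : e = 1 ∨ e = -1) :
    Real.cos (θ * ((t + e : ℤ) : ℝ)) + Real.cos (θ * ((t - e : ℤ) : ℝ)) =
      2 * Real.cos θ * Real.cos (θ * t) := by
  rcases he with rfl | rfl <;> push_cast <;> simp only [mul_add, mul_sub, Real.cos_add,
    Real.cos_sub, mul_neg, mul_one, Real.cos_neg, Real.sin_neg] <;> ring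

theorem abs_mul_intCast_le {θ a : ℝ} (h0 : 0 ≤ θ) {m : ℕ} (h : θ * m ≤ a) {t : ℤ}
    (ht : |t| ≤ m) : |θ * t| ≤ a := by
  rw [abs_mul, abs_of_nonneg h0]
  have : |(t : ℝ)| ≤ m := by exact_mod_cast ht
  exact (mul_le_mul_of_nonneg_left this h0).trans h

/-- The cosine is still nonnegative at distance L+1, so killing the walk there can only decrease the
eigenvalue identity. -/
theorem killedCos_add_le {θ : ℝ} {L : ℕ} (h0 : 0 ≤ θ) (h1 : θ * (L + 1 : ℕ) ≤ Real.pi / 2)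
    (x : ℤ) (k : ℕ) (c : Environment) (hc : IsOriented c) :
    killedCos θ L x (k + 1) c + killedCos θ L x (k + 1) (reverseLine (Sum.inr (x + k)) c) ≤
      2 * Real.cos θ * killedCos θ L x k c := by
  by_cases hk : Confined L x k c
  · have key : ∀ t : ℤ, |t| ≤ (L + 1 : ℕ) →
        (if |t| ≤ (L : ℤ) then Real.cos (θ * t) else 0) ≤ Real.cos (θ * t) := by
      intro t ht
      split_ifs
      · exact le_rfl
      · have := abs_le.1 (abs_mul_intCast_le h0 h1 ht)
        exact Real.cos_nonneg_of_mem_Icc ⟨by linarith [this.1], this.2⟩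
    have he := hc (Sum.inr (x + k))
    have ht := hk k le_rfl
    rw [killedCos_succ θ hk, killedCos_succ θ (confined_reverseLine.2 hk),
      partialSum_succ_reverseLine, partialSum_succ]
    rw [killedCos, if_pos hk, ← cos_add_cos_sub_of_sign θ _ _ he]
    have ht' := abs_le.1 ht
    refine add_le_add (key _ ?_) (key _ ?_) <;> rw [abs_le] <;> push_cast <;> omega
  · rw [killedCos_of_not hk, killedCos_of_not fun h => hk (confined_succ.1 h).1,
      killedCos_of_not fun h => hk (confined_reverseLine.1 (confined_succ.1 h).1)]
    simp

/-- Here the cosine vanishes exactly at distance L+1, so killing loses nothing: this is the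
Dirichlet eigenfunction of the interval. -/
theorem le_killedCos_add {θ : ℝ} {L : ℕ} (h1 : θ * (L + 1 : ℕ) = Real.pi / 2)
    (x : ℤ) (k : ℕ) (c : Environment) (hc : IsOriented c) :
    2 * Real.cos θ * killedCos θ L x k c ≤
      killedCos θ L x (k + 1) c + killedCos θ L x (k + 1) (reverseLine (Sum.inr (x + k)) c) := by
  by_cases hk : Confined L x k c
  · have key : ∀ t : ℤ, |t| ≤ (L + 1 : ℕ) →
        Real.cos (θ * t) ≤ (if |t| ≤ (L : ℤ) then Real.cos (θ * t) else 0) := by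
      intro t ht
      split_ifs with h
      · exact le_rfl
      · push_cast at ht
        have ht2 : |t| = L + 1 := by omega
        have : Real.cos (θ * t) = Real.cos (θ * (L + 1 : ℕ)) := by
          rcases abs_eq (by positivity : (0 : ℤ) ≤ L + 1) |>.1 ht2 with h | h
          · rw [h]; push_cast; rfl
          · rw [h, ← Real.cos_neg]; push_cast; congr 1; ring
        rw [this, h1, Real.cos_pi_div_two]
    have he := hc (Sum.inr (x + k))
    have ht := hk k le_rfl
    rw [killedCos_succ θ hk, killedCos_succ θ (confined_reverseLine.2 hk),
      partialSum_succ_reverseLine, partialSum_succ]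
    rw [killedCos, if_pos hk, ← cos_add_cos_sub_of_sign θ _ _ he]
    have ht' := abs_le.1 ht
    refine add_le_add (key _ ?_) (key _ ?_) <;> rw [abs_le] <;> push_cast <;> omega
  · rw [killedCos_of_not hk, killedCos_of_not fun h => hk (confined_succ.1 h).1,
      killedCos_of_not fun h => hk (confined_reverseLine.1 (confined_succ.1 h).1)]
    simp

theorem killedCos_zero (θ : ℝ) (L : ℕ) (x : ℤ) (c : Environment) : killedCos θ L x 0 c = 1 := by
  have : Confined L x 0 c := by
    intro i hi
    simp [Nat.le_zero.1 hi, partialSum]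
  simp [killedCos, this, partialSum]

theorem isRun_succ {y : ℤ} {j : ℕ} {c : Environment} :
    IsRun y (j + 1) c ↔ IsRun y j c ∧ c (Sum.inl (y + j)) = 1 := by
  constructor
  · exact fun h => ⟨fun i hi => h i (by omega), h j (by omega)⟩
  · rintro ⟨h, h'⟩ i hi
    rcases Nat.lt_or_ge i j with hk | hk
    · exact h i hk
    · rwa [show i = j by omega]

theorem isRun_reverseLine {y : ℤ} {j : ℕ} {c : Environment} :
    IsRun y j (reverseLine (Sum.inl (y + j)) c) ↔ IsRun y j c := by
  refine forall₂_congr fun i hi => ?_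
  rw [reverseLine_of_ne]
  simp only [ne_eq, Sum.inl.injEq, add_right_inj, Nat.cast_inj]
  omega

open Classical in
theorem ite_isRun_add (y : ℤ) (j : ℕ) (c : Environment) (hc : IsOriented c) :
    (if IsRun y (j + 1) c then (1 : ℝ) else 0) +
      (if IsRun y (j + 1) (reverseLine (Sum.inl (y + j)) c) then 1 else 0) =
      2 * (1 / 2) * if IsRun y j c then 1 else 0 := by
  simp only [isRun_succ, isRun_reverseLine, reverseLine_same]
  by_cases h : IsRun y j c <;> rcases hc (Sum.inl (y + j)) with h1 | h1 <;> simp [h, h1]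

open Classical in
theorem measurable_ite_isRun (y : ℤ) (j : ℕ) :
    Measurable fun c => if IsRun y j c then (1 : ℝ) else 0 :=
  Measurable.ite (measurableSet_isRun y j) measurable_const measurable_const

/-! ### Probabilities of runs and of confinement -/

section Law

variable {Ω : Type*} [MeasurableSpace Ω] {P : Measure Ω} {U V : ℤ → Ω → ℤ}

theorem IsRandomOrientation.integral_ite [IsProbabilityMeasure P]
    (h : IsRandomOrientation P U V) {p : Environment → Prop} [DecidablePred p] (hp : MeasurableSet {c | p c}) :
    ∫ ω, (if p (environment U V ω) then (1 : ℝ) else 0) ∂P =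
      P.real {ω | p (environment U V ω)} := by
  have : (fun ω => if p (environment U V ω) then (1 : ℝ) else 0) =
      {ω | p (environment U V ω)}.indicator 1 := by
    funext ω; simp [Set.indicator_apply]
  rw [this]
  exact integral_indicator_one (h.measurable_environment hp)

theorem IsRandomOrientation.real_isRun [IsProbabilityMeasure P]
    (h : IsRandomOrientation P U V) (y : ℤ) (j : ℕ) :
    P.real {ω | IsRun y j (environment U V ω)} = (1 / 2) ^ j := by
  classical
  have hb : ∀ j c, |if IsRun y j c then (1 : ℝ) else 0| ≤ 1 := by
    intro j c; split_ifs <;> simp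
  have h0 : ∀ c, IsRun y 0 c := fun c i hi => absurd hi (Nat.not_lt_zero i)
  rw [← h.integral_ite (measurableSet_isRun y j)]
  have h1 := h.integral_le_pow_of_reverseLine (fun j => Sum.inl (y + j))
    (measurable_ite_isRun y) hb (by norm_num : (0 : ℝ) ≤ 1 / 2)
    (fun j c hc => (ite_isRun_add y j c hc).le) j
  have h2 := h.pow_le_integral_of_reverseLine (fun j => Sum.inl (y + j))
    (measurable_ite_isRun y) hb (by norm_num : (0 : ℝ) ≤ 1 / 2)
    (fun j c hc => (ite_isRun_add y j c hc).ge) j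
  simp only [h0, if_true, integral_const, probReal_univ, one_smul, mul_one] at h1 h2
  exact le_antisymm h1 h2

/-- The partial sums of independent signs rarely stay in a bounded interval for a long time. -/
theorem IsRandomOrientation.real_confined_le [IsProbabilityMeasure P]
    (h : IsRandomOrientation P U V) (L : ℕ) (x : ℤ) (k : ℕ) :
    P.real {ω | Confined L x k (environment U V ω)} ≤
      2 * Real.exp (-(k / (8 * ((L : ℝ) + 1) ^ 2))) := by
  classical
  have hL : (0 : ℝ) < (L : ℝ) + 1 := by positivity
  have hpi := Real.pi_pos
  -- Half the Dirichlet frequency: the cosine stays at least √2/2 on the interval, so the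
  -- confinement indicator is at most twice `killedCos`.
  set θ : ℝ := Real.pi / (4 * ((L : ℝ) + 1)) with hθ
  have hθ0 : 0 ≤ θ := by positivity
  have hθL : θ * ((L + 1 : ℕ) : ℝ) = Real.pi / 4 := by
    rw [hθ]; push_cast; field_simp
  have hcos0 : 0 ≤ Real.cos θ := by
    refine Real.cos_nonneg_of_mem_Icc ⟨by linarith, ?_⟩
    have : θ * 1 ≤ θ * ((L + 1 : ℕ) : ℝ) :=
      mul_le_mul_of_nonneg_left (by push_cast; linarith [(Nat.cast_nonneg L : (0 : ℝ) ≤ L)]) hθ0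
    linarith
  have hcos1 : Real.cos θ ≤ Real.exp (-(1 / (8 * ((L : ℝ) + 1) ^ 2))) := by
    have h1 : |θ| ≤ Real.pi := by
      rw [abs_of_nonneg hθ0, hθ]
      exact div_le_self hpi.le (by linarith [(Nat.cast_nonneg L : (0 : ℝ) ≤ L)])
    have h2 := Real.cos_le_one_sub_mul_cos_sq h1
    have h3 : 2 / Real.pi ^ 2 * θ ^ 2 = 1 / (8 * ((L : ℝ) + 1) ^ 2) := by
      rw [hθ]; field_simp; norm_num
    have h4 := Real.add_one_le_exp (-(1 / (8 * ((L : ℝ) + 1) ^ 2)))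
    linarith
  have hint := h.integral_le_pow_of_reverseLine (fun k => Sum.inr (x + k))
    (measurable_killedCos θ L x) (fun k => abs_killedCos_le θ L x k) hcos0
    (killedCos_add_le hθ0 (by rw [hθL]; linarith) x) k
  simp only [killedCos_zero, integral_const, probReal_univ, one_smul, mul_one] at hint
  have hle : P.real {ω | Confined L x k (environment U V ω)} ≤
      2 * ∫ ω, killedCos θ L x k (environment U V ω) ∂P := by
    rw [← h.integral_ite (measurableSet_confined L x k), ← integral_const_mul]
    refine integral_mono (h.integrable (F := fun c => if Confined L x k c then (1 : ℝ) else 0)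
      (B := 1) (Measurable.ite (measurableSet_confined L x k) measurable_const measurable_const)
      fun c => by split_ifs <;> simp)
      ((h.integrable (measurable_killedCos θ L x k) (abs_killedCos_le θ L x k)).const_mul 2)
      fun ω => ?_
    simp only [killedCos]
    split_ifs with hc
    · have h1 : |partialSum (environment U V ω) x k| ≤ ((L + 1 : ℕ) : ℤ) := by
        have := hc k le_rfl
        push_cast; omega
      have h2 := abs_mul_intCast_le hθ0 hθL.le h1
      have h3 := Real.cos_le_cos_of_nonneg_of_le_pi (abs_nonneg _) (by linarith) h2
      rw [Real.cos_abs, Real.cos_pi_div_four] at h3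
      have : (1 : ℝ) ≤ √2 := by rw [Real.one_le_sqrt]; norm_num
      linarith
    · simp
  have hpow := pow_le_pow_left₀ hcos0 hcos1 k
  rw [← Real.exp_nat_mul] at hpow
  have e : (k : ℝ) * -(1 / (8 * ((L : ℝ) + 1) ^ 2)) = -(k / (8 * ((L : ℝ) + 1) ^ 2)) := by ring
  rw [e] at hpow
  linarith

/-- A lower bound for the probability of moving to the right inside a strip. -/
theorem IsRandomOrientation.le_real_isRun_confined [IsProbabilityMeasure P]
    (h : IsRandomOrientation P U V) (L : ℕ) (k : ℕ) :
    Real.cos (Real.pi / (2 * ((L : ℝ) + 1))) ^ k * (1 / 2) ^ (2 * L + 1) ≤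
      P.real {ω | IsRun (-L) (2 * L + 1) (environment U V ω) ∧
        Confined L 0 k (environment U V ω)} := by
  classical
  have hL : (0 : ℝ) < (L : ℝ) + 1 := by positivity
  have hpi := Real.pi_pos
  set θ : ℝ := Real.pi / (2 * ((L : ℝ) + 1)) with hθ
  have hθ0 : 0 ≤ θ := by positivity
  have hθL : θ * ((L + 1 : ℕ) : ℝ) = Real.pi / 2 := by
    rw [hθ]; push_cast; field_simp
  have hcos0 : 0 ≤ Real.cos θ := by
    refine Real.cos_nonneg_of_mem_Icc ⟨by linarith, ?_⟩
    have : θ * 1 ≤ θ * ((L + 1 : ℕ) : ℝ) :=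
      mul_le_mul_of_nonneg_left (by push_cast; linarith [(Nat.cast_nonneg L : (0 : ℝ) ≤ L)]) hθ0
    linarith
  -- The run indicator is carried along: it ignores reversals of vertical lines, so its probability
  -- enters only through `G 0`.
  let G : ℕ → Environment → ℝ := fun k c =>
    if IsRun (-L) (2 * L + 1) c then killedCos θ L 0 k c else 0
  have hG : ∀ k, Measurable (G k) := fun k =>
    Measurable.ite (measurableSet_isRun _ _) (measurable_killedCos θ L 0 k) measurable_const
  have hG1 : ∀ k c, |G k c| ≤ 1 := by
    intro k c
    simp only [G]
    split_ifs
    · exact abs_killedCos_le θ L 0 k c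
    · simp
  have hstep : ∀ k c, IsOriented c → 2 * Real.cos θ * G k c ≤
      G (k + 1) c + G (k + 1) (reverseLine (Sum.inr (0 + k)) c) := by
    intro k c hc
    have hr : IsRun (-L) (2 * L + 1) (reverseLine (Sum.inr (0 + k)) c) ↔
        IsRun (-L) (2 * L + 1) c := by
      refine forall₂_congr fun i hi => ?_
      rw [reverseLine_of_ne Sum.inl_ne_inr]
    simp only [G, hr]
    split_ifs
    · exact le_killedCos_add hθL 0 k c hc
    · simp
  have hint := h.pow_le_integral_of_reverseLine (fun k => Sum.inr (0 + k)) hG hG1 hcos0 hstep k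
  have h0 : ∫ ω, G 0 (environment U V ω) ∂P = (1 / 2) ^ (2 * L + 1) := by
    simp only [G, killedCos_zero]
    rw [h.integral_ite (measurableSet_isRun _ _), h.real_isRun]
  rw [h0] at hint
  refine hint.trans ?_
  have hm : MeasurableSet {c | IsRun (-L) (2 * L + 1) c ∧ Confined L 0 k c} :=
    (measurableSet_isRun _ _).inter (measurableSet_confined _ _ _)
  rw [← h.integral_ite (p := fun c => IsRun (-L) (2 * L + 1) c ∧ Confined L 0 k c) hm]
  refine integral_mono (h.integrable (hG k) (hG1 k))
    (h.integrable (F := fun c => if IsRun (-L) (2 * L + 1) c ∧ Confined L 0 k c then (1 : ℝ) else 0)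
      (B := 1) (Measurable.ite hm measurable_const measurable_const)
      fun c => by split_ifs <;> simp) fun ω => ?_
  simp only [G, killedCos]
  by_cases h1 : IsRun (-L) (2 * L + 1) (environment U V ω) <;>
    by_cases h2 : Confined L 0 k (environment U V ω) <;> simp [h1, h2, Real.cos_le_one]

end Law

/-! ### First visits, turns and trapping -/

/-- The path driven by the environment `c`. -/
def walk (c : Environment) (k : ℕ) : ℤ × ℤ :=
  diagonalWalk (fun y => c (Sum.inl y)) (fun x => c (Sum.inr x)) k

theorem walk_zero (c : Environment) : walk c 0 = (0, 0) := rfl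

theorem walk_succ (c : Environment) (k : ℕ) :
    walk c (k + 1) = ((walk c k).1 + c (Sum.inl (walk c k).2),
      (walk c k).2 + c (Sum.inr (walk c k).1)) := rfl

theorem measurable_eval_line (g : ℤ → ℤ ⊕ ℤ) :
    Measurable fun p : ℤ × Environment => p.2 (g p.1) :=
  measurable_from_prod_countable_right fun i => measurable_pi_apply (g i)

theorem measurable_walk (k : ℕ) : Measurable fun c => walk c k := by
  induction k with
  | zero => exact measurable_const
  | succ k ih =>
    simp only [walk_succ]
    have h1 : Measurable fun c => (walk c k).1 + c (Sum.inl (walk c k).2) :=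
      ih.fst.add ((measurable_eval_line Sum.inl).comp (ih.snd.prodMk measurable_id))
    have h2 : Measurable fun c => (walk c k).2 + c (Sum.inr (walk c k).1) :=
      ih.snd.add ((measurable_eval_line Sum.inr).comp (ih.fst.prodMk measurable_id))
    exact h1.prodMk h2

/-- The path visits the abscissa `x` for the first time at time `k`. -/
def FirstHit (c : Environment) (x : ℤ) (k : ℕ) : Prop :=
  (walk c k).1 = x ∧ ∀ j < k, (walk c j).1 ≠ x

/-- The path visits the abscissa `x`. -/
def Reaches (c : Environment) (x : ℤ) : Prop := ∃ k, FirstHit c x k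

/-- At the first visit to the abscissa `x`, the horizontal line is oriented to the left. -/
def TurnsAt (c : Environment) (x : ℤ) : Prop :=
  ∃ k, FirstHit c x k ∧ c (Sum.inl (walk c k).2) = -1

theorem reaches_of_walk {c : Environment} {x : ℤ} {k : ℕ} (h : (walk c k).1 = x) :
    ∃ j ≤ k, FirstHit c x j := by
  classical
  have hex : ∃ k, (walk c k).1 = x := ⟨k, h⟩
  exact ⟨Nat.find hex, Nat.find_min' hex h, Nat.find_spec hex, fun j hj => Nat.find_min hex hj⟩

theorem FirstHit.unique {c : Environment} {x : ℤ} {j k : ℕ} (hj : FirstHit c x j)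
    (hk : FirstHit c x k) : j = k := by
  rcases lt_trichotomy j k with h | h | h
  · exact absurd hj.1 (hk.2 j h)
  · exact h
  · exact absurd hk.1 (hj.2 k h)

/-- Horizontal steps are ±1, so an abscissa cannot be jumped over. -/
theorem walk_fst_lt_of_ne {c : Environment} (hc : IsOriented c) {x : ℤ} (hx : 0 < x) {k : ℕ}
    (h : ∀ j ≤ k, (walk c j).1 ≠ x) : (walk c k).1 < x := by
  induction k with
  | zero => simpa [walk_zero] using hx
  | succ k ih =>
    have h1 := ih fun j hj => h j (by omega)
    have h2 := h (k + 1) le_rfl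
    simp only [walk_succ] at h2 ⊢
    rcases hc (Sum.inl (walk c k).2) with h3 | h3 <;> omega

theorem FirstHit.fst_lt {c : Environment} (hc : IsOriented c) {x : ℤ} (hx : 0 < x) {k : ℕ}
    (h : FirstHit c x k) {j : ℕ} (hj : j < k) : (walk c j).1 < x :=
  walk_fst_lt_of_ne hc hx fun i hi => h.2 i (by omega)

theorem exists_firstHit_le {c : Environment} (hc : IsOriented c) {x : ℤ} (hx : 0 < x) {k : ℕ}
    (h : x ≤ (walk c k).1) : ∃ j ≤ k, FirstHit c x j := by
  by_contra hcon
  refine absurd (walk_fst_lt_of_ne hc hx (k := k) fun j hj hjx => hcon ?_) (not_lt.2 h)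
  obtain ⟨i, hi, hi'⟩ := reaches_of_walk hjx
  exact ⟨i, hi.trans hj, hi'⟩

/-- A vertical line is consulted only on leaving its abscissa, so its orientation is still fresh at
the first visit. -/
theorem walk_reverseLine_eq {c : Environment} {x : ℤ} {k : ℕ}
    (h : ∀ j < k, (walk c j).1 ≠ x) : walk (reverseLine (Sum.inr x) c) k = walk c k := by
  induction k with
  | zero => rfl
  | succ k ih =>
    have h1 := ih fun j hj => h j (by omega)
    have h2 := h k (by omega)
    rw [walk_succ, walk_succ, h1, reverseLine_of_ne (by simp), reverseLine_of_ne (by simpa using h2)]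

theorem reverseLine_reverseLine (i : ℤ ⊕ ℤ) (c : Environment) :
    reverseLine i (reverseLine i c) = c := by
  funext j
  by_cases h : j = i
  · subst h; simp [reverseLine_same]
  · simp [reverseLine_of_ne h]

theorem IsOriented.reverseLine {c : Environment} (hc : IsOriented c) (i : ℤ ⊕ ℤ) :
    IsOriented (_root_.reverseLine i c) := by
  intro j
  by_cases h : j = i
  · subst h; rw [reverseLine_same]; rcases hc j with h | h <;> simp [h]
  · rw [reverseLine_of_ne h]; exact hc j

theorem FirstHit.walk_reverseLine {c : Environment} (hc : IsOriented c) {x' x : ℤ} (hx' : 0 < x')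
    (hx : x' ≤ x) {k : ℕ} (h : FirstHit c x' k) {j : ℕ} (hj : j ≤ k) :
    walk (_root_.reverseLine (Sum.inr x) c) j = walk c j :=
  walk_reverseLine_eq fun _ hi =>
    ((h.fst_lt hc hx' (hi.trans_le hj)).trans_le hx).ne

theorem FirstHit.reverseLine {c : Environment} (hc : IsOriented c) {x' x : ℤ} (hx' : 0 < x')
    (hx : x' ≤ x) {k : ℕ} (h : FirstHit c x' k) : FirstHit (reverseLine (Sum.inr x) c) x' k := by
  refine ⟨?_, fun j hj => ?_⟩
  · rw [h.walk_reverseLine hc hx' hx le_rfl]; exact h.1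
  · rw [h.walk_reverseLine hc hx' hx hj.le]; exact h.2 j hj

theorem reaches_reverseLine {c : Environment} (hc : IsOriented c) {x' x : ℤ} (hx' : 0 < x')
    (hx : x' ≤ x) : Reaches (reverseLine (Sum.inr x) c) x' ↔ Reaches c x' := by
  constructor
  · rintro ⟨k, hk⟩
    have := hk.reverseLine (hc.reverseLine _) hx' hx
    rw [reverseLine_reverseLine] at this
    exact ⟨k, this⟩
  · rintro ⟨k, hk⟩
    exact ⟨k, hk.reverseLine hc hx' hx⟩

theorem TurnsAt.reverseLine {c : Environment} (hc : IsOriented c) {x' x : ℤ} (hx' : 0 < x')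
    (hx : x' ≤ x) (h : TurnsAt c x') : TurnsAt (reverseLine (Sum.inr x) c) x' := by
  obtain ⟨k, hk, hu⟩ := h
  refine ⟨k, hk.reverseLine hc hx' hx, ?_⟩
  rw [hk.walk_reverseLine hc hx' hx le_rfl, reverseLine_of_ne (by simp)]
  exact hu

theorem turnsAt_reverseLine {c : Environment} (hc : IsOriented c) {x' x : ℤ} (hx' : 0 < x')
    (hx : x' ≤ x) : TurnsAt (reverseLine (Sum.inr x) c) x' ↔ TurnsAt c x' := by
  refine ⟨fun h => ?_, fun h => h.reverseLine hc hx' hx⟩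
  have := h.reverseLine (hc.reverseLine _) hx' hx
  rwa [reverseLine_reverseLine] at this

/-- If the path turns at a new abscissa `x` and the new vertical line is opposite to the previous
one, then the path is trapped on two vertices. -/
theorem not_reaches_of_turnsAt {c : Environment} (hc : IsOriented c) {x : ℤ} (hx : 0 < x)
    (h : TurnsAt c x) (hv : c (Sum.inr x) = -c (Sum.inr (x - 1))) : ¬ Reaches c (x + 1) := by
  obtain ⟨k, hk, hu⟩ := h
  obtain ⟨n, rfl⟩ : ∃ n, k = n + 1 := by
    refine Nat.exists_eq_succ_of_ne_zero ?_
    rintro rfl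
    have := hk.1
    simp only [walk_zero] at this
    omega
  have hlt := hk.fst_lt hc hx (Nat.lt_succ_self n)
  have hX := hk.1
  have hX0 : (walk c n).1 = x - 1 ∧ c (Sum.inl (walk c n).2) = 1 := by
    rw [walk_succ] at hX
    simp only at hX
    rcases hc (Sum.inl (walk c n).2) with h3 | h3 <;> constructor <;> omega
  -- The step into x is right, with vertical part `c (Sum.inr (x - 1))`; the next is left, with the
  -- opposite vertical part.
  have hper : walk c (n + 2) = walk c n := by
    rw [walk_succ c (n + 1), hu, hX, hv, walk_succ c n, hX0.1]
    ext
    · simp only; omega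
    · simp only; ring
  have hall : ∀ i, walk c (n + i) = walk c n ∨ walk c (n + i) = walk c (n + 1) := by
    intro i
    induction i with
    | zero => exact Or.inl rfl
    | succ i ih =>
      rw [← add_assoc, walk_succ c (n + i)]
      rcases ih with h | h
      · right; rw [h, walk_succ c n]
      · left; rw [h, ← walk_succ, hper]
  rintro ⟨j, hj⟩
  have hj1 := hj.1
  rcases Nat.lt_or_ge j n with h | h
  · have := hk.fst_lt hc hx (show j < n + 1 by omega)
    omega
  · obtain ⟨i, rfl⟩ := Nat.exists_eq_add_of_le h
    rcases hall i with h | h <;> rw [h] at hj1 <;> omega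

open Classical in
/-- The weight `2 ^ t`, where `t` is the number of turns at the abscissae `1, …, n`, on the event
that the path reaches the abscissa `n + 1`. -/
noncomputable def turnWeight (n : ℕ) (c : Environment) : ℝ :=
  if Reaches c (n + 1 : ℕ) then ∏ i ∈ Finset.range n, (if TurnsAt c (i + 1 : ℕ) then 2 else 1)
  else 0

theorem measurableSet_firstHit (x : ℤ) (k : ℕ) : MeasurableSet {c | FirstHit c x k} := by
  have hm : ∀ j, MeasurableSet {c | (walk c j).1 = x} := fun j =>
    (measurable_walk j).fst (measurableSet_singleton x)
  have : {c | FirstHit c x k} =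
      {c | (walk c k).1 = x} ∩ ⋂ j : ℕ, ⋂ _ : j < k, {c | (walk c j).1 = x}ᶜ := by
    ext c; simp [FirstHit]
  rw [this]
  exact (hm k).inter (MeasurableSet.iInter fun j => MeasurableSet.iInter fun _ => (hm j).compl)

theorem measurableSet_reaches (x : ℤ) : MeasurableSet {c | Reaches c x} := by
  have : {c | Reaches c x} = ⋃ k, {c | FirstHit c x k} := by ext c; simp [Reaches]
  rw [this]
  exact MeasurableSet.iUnion fun k => measurableSet_firstHit x k

theorem measurableSet_turnsAt (x : ℤ) : MeasurableSet {c | TurnsAt c x} := by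
  have : {c | TurnsAt c x} =
      ⋃ k, ({c | FirstHit c x k} ∩ {c | c (Sum.inl (walk c k).2) = -1}) := by
    ext c; simp [TurnsAt]
  rw [this]
  refine MeasurableSet.iUnion fun k => (measurableSet_firstHit x k).inter ?_
  exact ((measurable_eval_line Sum.inl).comp ((measurable_walk k).snd.prodMk measurable_id))
    (measurableSet_singleton (-1))

theorem measurable_turnWeight (n : ℕ) : Measurable (turnWeight n) := by
  refine Measurable.ite (measurableSet_reaches _) ?_ measurable_const
  exact Finset.measurable_fun_prod _ fun i _ =>
    Measurable.ite (measurableSet_turnsAt _) measurable_const measurable_const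

open Classical in
theorem prod_turns_eq (n : ℕ) (c : Environment) :
    ∏ i ∈ Finset.range n, (if TurnsAt c (i + 1 : ℕ) then (2 : ℝ) else 1) =
      2 ^ ((Finset.range n).filter fun i : ℕ => TurnsAt c (i + 1 : ℕ)).card := by
  rw [Finset.prod_ite]; simp

theorem turnWeight_nonneg (n : ℕ) (c : Environment) : 0 ≤ turnWeight n c := by
  unfold turnWeight
  split_ifs
  · exact Finset.prod_nonneg fun i _ => by split_ifs <;> norm_num
  · exact le_rfl

theorem abs_turnWeight_le (n : ℕ) (c : Environment) : |turnWeight n c| ≤ 2 ^ n := by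
  classical
  rw [abs_of_nonneg (turnWeight_nonneg n c)]
  unfold turnWeight
  split_ifs
  · rw [prod_turns_eq]
    refine pow_le_pow_right₀ (by norm_num) ?_
    simpa using Finset.card_filter_le (Finset.range n) fun i : ℕ => TurnsAt c (i + 1 : ℕ)
  · positivity

/-- Reversing the vertical line at n+1 alters neither the turns up to n+1 nor the arrival there. At
a turn, one of its two orientations traps the path, which compensates the factor 2; without a turn
no factor appears. -/
theorem turnWeight_add_le (n : ℕ) (c : Environment) (hc : IsOriented c) :
    turnWeight (n + 1) c + turnWeight (n + 1) (reverseLine (Sum.inr (n + 1 : ℕ)) c) ≤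
      2 * 1 * turnWeight n c := by
  classical
  set c' := reverseLine (Sum.inr ((n + 1 : ℕ) : ℤ)) c with hc'
  have hco' : IsOriented c' := hc.reverseLine _
  have hsub : ∀ d : Environment, IsOriented d → Reaches d ((n + 1 + 1 : ℕ) : ℤ) →
      Reaches d ((n + 1 : ℕ) : ℤ) := by
    rintro d hd ⟨k, hk⟩
    obtain ⟨j, -, hj⟩ := exists_firstHit_le hd (x := ((n + 1 : ℕ) : ℤ)) (by positivity) (k := k)
      (by rw [hk.1]; push_cast; omega)
    exact ⟨j, hj⟩
  have hR : Reaches c' ((n + 1 : ℕ) : ℤ) ↔ Reaches c ((n + 1 : ℕ) : ℤ) :=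
    reaches_reverseLine hc (by positivity) le_rfl
  have hT : ∀ i : ℕ, i ≤ n → (TurnsAt c' ((i + 1 : ℕ) : ℤ) ↔ TurnsAt c ((i + 1 : ℕ) : ℤ)) :=
    fun i hi => turnsAt_reverseLine hc (by positivity) (by push_cast; omega)
  have hprod : ∏ i ∈ Finset.range (n + 1), (if TurnsAt c' (i + 1 : ℕ) then (2 : ℝ) else 1) =
      ∏ i ∈ Finset.range (n + 1), (if TurnsAt c (i + 1 : ℕ) then (2 : ℝ) else 1) := by
    refine Finset.prod_congr rfl fun i hi => ?_
    have := Finset.mem_range.1 hi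
    simp only [hT i (by omega)]
  simp only [turnWeight, hprod]
  rw [Finset.prod_range_succ]
  have hp : 0 ≤ ∏ i ∈ Finset.range n, (if TurnsAt c (i + 1 : ℕ) then (2 : ℝ) else 1) :=
    Finset.prod_nonneg fun i _ => by split_ifs <;> norm_num
  generalize ∏ i ∈ Finset.range n, (if TurnsAt c (i + 1 : ℕ) then (2 : ℝ) else 1) = p at hp ⊢
  by_cases hr : Reaches c ((n + 1 : ℕ) : ℤ)
  · rw [if_pos hr]
    by_cases ht : TurnsAt c ((n + 1 : ℕ) : ℤ)
    · rw [if_pos ht]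
      have hnot : ¬ (Reaches c ((n + 1 + 1 : ℕ) : ℤ) ∧ Reaches c' ((n + 1 + 1 : ℕ) : ℤ)) := by
        rintro ⟨h1, h2⟩
        have hpos : (0 : ℤ) < ((n + 1 : ℕ) : ℤ) := by positivity
        have t1 := mt (not_reaches_of_turnsAt hc hpos ht) (not_not.2 h1)
        have t2 := mt (not_reaches_of_turnsAt hco' hpos ((hT n le_rfl).2 ht)) (not_not.2 h2)
        rw [hc', reverseLine_same, reverseLine_of_ne (by simp)] at t2
        rcases hc (Sum.inr ((n + 1 : ℕ) : ℤ)) with h3 | h3 <;>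
          rcases hc (Sum.inr (((n + 1 : ℕ) : ℤ) - 1)) with h4 | h4 <;>
              rw [h3, h4] at t1 t2 <;> omega
      by_cases h1 : Reaches c ((n + 1 + 1 : ℕ) : ℤ) <;>
        by_cases h2 : Reaches c' ((n + 1 + 1 : ℕ) : ℤ)
      · exact absurd ⟨h1, h2⟩ hnot
      all_goals simp only [h1, h2, if_true, if_false]; linarith
    · rw [if_neg ht]
      split_ifs <;> linarith
  · rw [if_neg fun h => hr (hsub c hc h), if_neg fun h => hr (hR.1 (hsub c' hco' h)), if_neg hr]
    simp

section Law

variable {Ω : Type*} [MeasurableSpace Ω] {P : Measure Ω} {U V : ℤ → Ω → ℤ}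

open Classical in
/-- The path rarely turns many times at new abscissae without being trapped. -/
theorem IsRandomOrientation.real_turns_le [IsProbabilityMeasure P]
    (h : IsRandomOrientation P U V) (n K : ℕ) :
    P.real {ω | Reaches (environment U V ω) (n + 1 : ℕ) ∧
      K ≤ ((Finset.range n).filter fun i : ℕ =>
        TurnsAt (environment U V ω) (i + 1 : ℕ)).card} ≤ (1 / 2) ^ K := by
  have hint := h.integral_le_pow_of_reverseLine (fun n => Sum.inr ((n + 1 : ℕ) : ℤ))
    measurable_turnWeight abs_turnWeight_le zero_le_one turnWeight_add_le n
  have h0 : ∫ ω, turnWeight 0 (environment U V ω) ∂P ≤ 1 := by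
    have := integral_mono (μ := P) (h.integrable (measurable_turnWeight 0) (abs_turnWeight_le 0))
      (integrable_const (1 : ℝ)) fun ω => by
        have := (le_abs_self _).trans (abs_turnWeight_le 0 (environment U V ω))
        simpa using this
    simpa using this
  rw [one_pow, one_mul] at hint
  -- Markov's inequality at level 2^K, for a weight of mean at most 1.
  have hmarkov := mul_meas_ge_le_integral_of_nonneg (μ := P)
    (f := fun ω => turnWeight n (environment U V ω))
    (Filter.Eventually.of_forall fun ω => turnWeight_nonneg n _)
    (h.integrable (measurable_turnWeight n) (abs_turnWeight_le n)) (2 ^ K)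
  have hsub : P.real {ω | Reaches (environment U V ω) (n + 1 : ℕ) ∧
      K ≤ ((Finset.range n).filter fun i : ℕ =>
        TurnsAt (environment U V ω) (i + 1 : ℕ)).card} ≤
      P.real {ω | 2 ^ K ≤ turnWeight n (environment U V ω)} := by
    refine measureReal_mono ?_
    rintro ω ⟨h1, h2⟩
    show 2 ^ K ≤ turnWeight n (environment U V ω)
    rw [turnWeight, if_pos h1, prod_turns_eq]
    exact pow_le_pow_right₀ (by norm_num) h2
  have h2 : (0 : ℝ) < 2 ^ K := by positivity
  have hcomb := (mul_le_mul_of_nonneg_left hsub h2.le).trans (hmarkov.trans (hint.trans h0))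
  rw [one_div, inv_pow, ← one_div, le_div_iff₀ h2]
  linarith

end Law

/-! ### Anatomy of an exit to the right -/

/-- The path reaches the abscissa `m` while staying at heights in `[-m, m]`. -/
def RightExit (m : ℕ) (c : Environment) : Prop :=
  ∃ k, (walk c k).1 = m ∧ ∀ j ≤ k, |(walk c j).2| ≤ m

/-- Discrete intermediate values: the increments are ±1. Hence the heights visited on a straight
stretch form an interval. -/
theorem exists_partialSum_eq {c : Environment} (hc : IsOriented c) (x : ℤ) {i : ℕ} {z : ℤ}
    (hz : (0 ≤ z ∧ z ≤ partialSum c x i) ∨ (partialSum c x i ≤ z ∧ z ≤ 0)) :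
    ∃ j ≤ i, partialSum c x j = z := by
  induction i with
  | zero =>
    have h0 : partialSum c x 0 = 0 := by simp [partialSum]
    exact ⟨0, le_rfl, by omega⟩
  | succ i ih =>
    by_cases h : partialSum c x (i + 1) = z
    · exact ⟨i + 1, le_rfl, h⟩
    · rw [partialSum_succ] at h hz
      obtain ⟨j, hj, hj'⟩ := ih (by rcases hc (Sum.inr (x + i)) with h1 | h1 <;> omega)
      exact ⟨j, by omega, hj'⟩

/-- As long as the path does not turn at new abscissae, it goes straight to the right, and its
height follows the partial sums of the vertical orientations. -/
theorem firstHit_add_of_not_turnsAt {c : Environment} (hc : IsOriented c) {x : ℤ} (hx : 0 < x)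
    {k : ℕ} (hk : FirstHit c x k) {M : ℕ} (hM : ∀ i < M, ¬ TurnsAt c (x + (i : ℕ))) {i : ℕ}
    (hi : i ≤ M) :
    FirstHit c (x + i) (k + i) ∧ (walk c (k + i)).2 = (walk c k).2 + partialSum c x i := by
  induction i with
  | zero => simpa [partialSum] using hk
  | succ i ih =>
    obtain ⟨h1, h2⟩ := ih (by omega)
    have hu : c (Sum.inl (walk c (k + i)).2) = 1 :=
      (hc _).resolve_right fun h => hM i (by omega) ⟨k + i, h1, h⟩
    have hX := h1.1
    refine ⟨⟨?_, fun j hj => ?_⟩, ?_⟩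
    · rw [← add_assoc, walk_succ, hX, hu]; push_cast; ring
    · have : (walk c j).1 ≤ x + i := by
        rcases Nat.lt_or_ge j (k + i) with h | h
        · exact (h1.fst_lt hc (by positivity) h).le
        · rw [show j = k + i by omega, hX]
      push_cast; omega
    · rw [← add_assoc, walk_succ, hX, partialSum_succ]
      simp only [h2]; ring

open Classical in
-- Pigeonhole: choosing a point of `p` in each of the K disjoint blocks of length M would give K
-- distinct points.
theorem exists_block_of_card_lt {K M : ℕ} {p : ℕ → Prop}
    (h : ((Finset.range (K * M)).filter p).card < K) :
    ∃ j < K, ∀ i < M, ¬ p (j * M + i) := by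
  by_contra! hcon
  choose! f hf hp using hcon
  refine absurd h (not_lt.2 ?_)
  have hinj : Set.InjOn (fun j => j * M + f j) (Finset.range K : Set ℕ) := by
    intro a ha b hb hab
    simp only [Finset.coe_range, Set.mem_Iio] at ha hb
    have h1 := hf a ha
    have h2 := hf b hb
    simp only at hab
    have e1 : (a * M + f a) / M = a := by
      rw [mul_comm, Nat.mul_add_div (by omega), Nat.div_eq_of_lt h1, add_zero]
    have e2 : (b * M + f b) / M = b := by
      rw [mul_comm, Nat.mul_add_div (by omega), Nat.div_eq_of_lt h2, add_zero]
    rw [← e1, ← e2, hab]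
  have hmaps : ∀ j ∈ Finset.range K, j * M + f j ∈ (Finset.range (K * M)).filter p := by
    intro j hj
    have hj := Finset.mem_range.1 hj
    have h1 := hf j hj
    rw [Finset.mem_filter, Finset.mem_range]
    refine ⟨?_, hp j hj⟩
    calc j * M + f j < j * M + M := by omega
      _ = (j + 1) * M := by ring
      _ ≤ K * M := Nat.mul_le_mul_right M hj
  simpa using Finset.card_le_card_of_injOn _ hmaps hinj

open Classical in
/-- An exit to the right requires many turns, or a long run of horizontal lines, or an
unusually long confinement of the partial sums. -/
theorem RightExit.cases {c : Environment} (hc : IsOriented c) (K M L : ℕ)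
    (h : RightExit (K * (M + 1) + 1) c) :
    (Reaches c (K * (M + 1) + 1 : ℕ) ∧ K ≤ ((Finset.range (K * (M + 1))).filter fun i : ℕ =>
        TurnsAt c (i + 1 : ℕ)).card) ∨
      (∃ y ∈ Finset.Icc (-((K * (M + 1) + 1 : ℕ) : ℤ)) (K * (M + 1) + 1 : ℕ),
        IsRun y (L + 1) c) ∨
      ∃ j ∈ Finset.range K, Confined L ((j * (M + 1) + 1 : ℕ) : ℤ) M c := by
  obtain ⟨k, hk, hY⟩ := h
  set m := K * (M + 1) + 1 with hm
  by_cases hcard : K ≤ ((Finset.range (K * (M + 1))).filter fun i : ℕ =>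
        TurnsAt c (i + 1 : ℕ)).card
  · obtain ⟨j, -, hj⟩ := reaches_of_walk hk
    exact Or.inl ⟨⟨j, hj⟩, hcard⟩
  right
  obtain ⟨j, hjK, hj⟩ := exists_block_of_card_lt (not_le.1 hcard)
  -- Index `i` in the count stands for abscissa i+1, hence the shift. The M+1 abscissae of the block
  -- control the lines met after 0, …, M vertical increments.
  set x : ℤ := ((j * (M + 1) + 1 : ℕ) : ℤ) with hx
  have hx0 : 0 < x := by positivity
  have hblock : (j + 1) * (M + 1) ≤ K * (M + 1) := Nat.mul_le_mul_right _ hjK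
  have hxm : x + M < m := by
    rw [hx, hm]; zify at hblock; push_cast; linarith
  obtain ⟨k₀, -, hk₀⟩ := exists_firstHit_le hc hx0 (k := k) (by rw [hk]; omega)
  have hgood : ∀ i < M + 1, ¬ TurnsAt c (x + (i : ℕ)) := by
    intro i hi
    have := hj i hi
    convert this using 2
    rw [hx]; push_cast; ring
  have hpath := fun i (hi : i ≤ M + 1) => firstHit_add_of_not_turnsAt hc hx0 hk₀ hgood hi
  have hrow : ∀ i ≤ M, |(walk c k₀).2 + partialSum c x i| ≤ m ∧
      c (Sum.inl ((walk c k₀).2 + partialSum c x i)) = 1 := by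
    intro i hi
    obtain ⟨h1, h2⟩ := hpath i (by omega)
    rw [← h2]
    constructor
    · refine hY _ ?_
      -- The block lies left of `m`, so it is first crossed before time `k`, while heights are still
      -- bounded by `m`.
      obtain ⟨l, hl, hl'⟩ := exists_firstHit_le hc (x := x + i) (by positivity) (k := k)
        (by rw [hk]; omega)
      rw [h1.unique hl']; exact hl
    · exact (hc _).resolve_right fun h => hgood i (by omega) ⟨_, h1, h⟩
  by_cases hconf : Confined L x M c
  · exact Or.inr ⟨j, Finset.mem_range.2 hjK, hconf⟩
  left
  simp only [Confined, not_forall, not_le] at hconf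
  obtain ⟨i, hi, hLi⟩ := hconf
  have hrun : ∀ z : ℤ, (0 ≤ z ∧ z ≤ partialSum c x i) ∨ (partialSum c x i ≤ z ∧ z ≤ 0) →
      |(walk c k₀).2 + z| ≤ m ∧ c (Sum.inl ((walk c k₀).2 + z)) = 1 := by
    intro z hz
    obtain ⟨l, hl, rfl⟩ := exists_partialSum_eq hc x hz
    exact hrow l (hl.trans hi)
  -- The run starts at its lowest line: the entry height for an upward excursion, the excursion's
  -- endpoint for a downward one.
  rcases lt_abs.1 hLi with h | h
  · refine ⟨(walk c k₀).2 + 0, ?_, fun l hl => ?_⟩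
    · exact Finset.mem_Icc.2 (abs_le.1 (hrun 0 (by omega)).1)
    · rw [add_assoc]; exact (hrun (0 + l) (by omega)).2
  · refine ⟨(walk c k₀).2 + partialSum c x i, ?_, fun l hl => ?_⟩
    · exact Finset.mem_Icc.2 (abs_le.1 (hrun _ (by omega)).1)
    · rw [add_assoc]; exact (hrun _ (by omega)).2

/-! ### Probability of an exit to the right -/

/-- Half of the exponential rate is spent on absorbing the polynomial factor K^4 of the union bound.
-/
theorem pow_four_mul_exp_le {t : ℝ} (ht : 0 ≤ t) : t ^ 4 * Real.exp (-(2 * t)) ≤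
    24 * Real.exp (-t) := by
  have h := Real.pow_div_factorial_le_exp t ht 4
  have h2 : t ^ 4 ≤ 24 * Real.exp t := by
    simp only [Nat.factorial] at h; push_cast at h; linarith
  calc t ^ 4 * Real.exp (-(2 * t)) ≤ 24 * Real.exp t * Real.exp (-(2 * t)) :=
        mul_le_mul_of_nonneg_right h2 (Real.exp_pos _).le
    _ = 24 * Real.exp (-t) := by rw [mul_assoc, ← Real.exp_add]; ring_nf

theorem mul_exp_le {t : ℝ} : t * Real.exp (-(2 * t)) ≤ Real.exp (-t) := by
  have h2 : t ≤ Real.exp t := by linarith [Real.add_one_le_exp t]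
  calc t * Real.exp (-(2 * t)) ≤ Real.exp t * Real.exp (-(2 * t)) :=
        mul_le_mul_of_nonneg_right h2 (Real.exp_pos _).le
    _ = Real.exp (-t) := by rw [← Real.exp_add]; ring_nf

theorem half_pow_le_exp (K : ℕ) : ((1 : ℝ) / 2) ^ K ≤ Real.exp (-(K / 2)) := by
  have h1 : (1 : ℝ) / 2 ≤ Real.exp (-(1 / 2)) := by
    linarith [Real.add_one_le_exp (-(1 / 2) : ℝ)]
  have h2 := pow_le_pow_left₀ (by norm_num) h1 K
  rw [← Real.exp_nat_mul] at h2
  refine h2.trans_eq ?_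
  congr 1; ring

section Law

variable {Ω : Type*} [MeasurableSpace Ω] {P : Measure Ω} {U V : ℤ → Ω → ℤ}

theorem IsRandomOrientation.real_rightExit_le [IsProbabilityMeasure P]
    (h : IsRandomOrientation P U V) (K M L : ℕ) :
    P.real {ω | RightExit (K * (M + 1) + 1) (environment U V ω)} ≤
      (1 / 2) ^ K + (2 * (K * (M + 1) + 1) + 1) * (1 / 2) ^ (L + 1) +
        K * (2 * Real.exp (-(M / (8 * ((L : ℝ) + 1) ^ 2)))) := by
  classical
  set m := K * (M + 1) + 1 with hm
  have hsub : {ω | RightExit m (environment U V ω)} ⊆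
      {ω | Reaches (environment U V ω) (K * (M + 1) + 1 : ℕ) ∧
        K ≤ ((Finset.range (K * (M + 1))).filter fun i : ℕ =>
          TurnsAt (environment U V ω) (i + 1 : ℕ)).card} ∪
      ((⋃ y ∈ Finset.Icc (-((m : ℕ) : ℤ)) m, {ω | IsRun y (L + 1) (environment U V ω)}) ∪
        ⋃ j ∈ Finset.range K,
          {ω | Confined L ((j * (M + 1) + 1 : ℕ) : ℤ) M (environment U V ω)}) := by
    intro ω hω
    rcases RightExit.cases (h.isOriented ω) K M L hω with h1 | ⟨y, hy, h1⟩ | ⟨j, hj, h1⟩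
    · exact Or.inl h1
    · exact Or.inr (Or.inl (Set.mem_biUnion hy h1))
    · exact Or.inr (Or.inr (Set.mem_biUnion hj h1))
  have b1 := h.real_turns_le (K * (M + 1)) K
  have b2 : P.real (⋃ y ∈ Finset.Icc (-((m : ℕ) : ℤ)) m,
      {ω | IsRun y (L + 1) (environment U V ω)}) ≤ (2 * (K * (M + 1) + 1) + 1) * (1 / 2) ^ (L + 1) := by
    refine (measureReal_biUnion_finset_le _ _).trans ?_
    simp only [h.real_isRun, Finset.sum_const, nsmul_eq_mul, Int.card_Icc]
    refine le_of_eq ?_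
    congr 1
    have : ((m : ℤ) + 1 - -(m : ℤ)).toNat = 2 * m + 1 := by omega
    rw [this, hm]; push_cast; ring
  have b3 : P.real (⋃ j ∈ Finset.range K,
      {ω | Confined L ((j * (M + 1) + 1 : ℕ) : ℤ) M (environment U V ω)}) ≤
      K * (2 * Real.exp (-(M / (8 * ((L : ℝ) + 1) ^ 2)))) := by
    refine (measureReal_biUnion_finset_le _ _).trans ?_
    refine (Finset.sum_le_card_nsmul _ _ _ fun j _ => h.real_confined_le L _ M).trans_eq ?_
    simp
  have := measureReal_mono (μ := P) hsub
  have u1 := this.trans (measureReal_union_le _ _)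
  have u2 := measureReal_union_le (μ := P) (⋃ y ∈ Finset.Icc (-((m : ℕ) : ℤ)) m,
    {ω | IsRun y (L + 1) (environment U V ω)}) (⋃ j ∈ Finset.range K,
          {ω | Confined L ((j * (M + 1) + 1 : ℕ) : ℤ) M (environment U V ω)})
  linarith

/-- The half-width of the box used to bound the probability of reaching distance `≍ K ^ 4`. -/
def boxWidth (K : ℕ) : ℕ := K * (K ^ 3 + 1) + 1

theorem IsRandomOrientation.real_rightExit_boxWidth_le [IsProbabilityMeasure P]
    (h : IsRandomOrientation P U V) (K : ℕ) :
    P.real {ω | RightExit (boxWidth K) (environment U V ω)} ≤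
      10 ^ 9 * Real.exp (-(K / 64)) := by
  have hb := h.real_rightExit_le K (K ^ 3) K
  have hK : (0 : ℝ) ≤ K := Nat.cast_nonneg K
  -- For K ≥ 1, (K+1)^2 ≤ 4K^2 gives K^3 / (8(K+1)^2) ≥ K/32 = 2t.
  set t : ℝ := K / 64 with ht
  have ht0 : 0 ≤ t := by positivity
  have hKt : (K : ℝ) = 64 * t := by rw [ht]; ring
  have e0 : Real.exp (-(K / 2 : ℝ)) ≤ Real.exp (-t) := by
    rw [Real.exp_le_exp, hKt]; linarith
  have e1 : Real.exp (-(K / 2 : ℝ)) ≤ Real.exp (-(2 * t)) := by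
    rw [Real.exp_le_exp, hKt]; linarith
  have h1 := half_pow_le_exp K
  have h2 : ((1 : ℝ) / 2) ^ (K + 1) ≤ Real.exp (-(2 * t)) := by
    rw [pow_succ]
    have : (0 : ℝ) ≤ (1 / 2) ^ K := by positivity
    linarith
  have h3 : Real.exp (-(((K ^ 3 : ℕ) : ℝ) / (8 * ((K : ℝ) + 1) ^ 2))) ≤ Real.exp (-(2 * t)) := by
    rw [Real.exp_le_exp, neg_le_neg_iff, le_div_iff₀ (by positivity), ht]
    push_cast
    rcases Nat.eq_zero_or_pos K with h0 | h0
    · simp [h0]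
    · have : (1 : ℝ) ≤ K := by exact_mod_cast h0
      have h4 : ((K : ℝ) + 1) ^ 2 ≤ 4 * K ^ 2 := by nlinarith
      calc 2 * ((K : ℝ) / 64) * (8 * (K + 1) ^ 2) = (K : ℝ) / 4 * (K + 1) ^ 2 := by ring
        _ ≤ (K : ℝ) / 4 * (4 * K ^ 2) := mul_le_mul_of_nonneg_left h4 (by positivity)
        _ = (K : ℝ) ^ 3 := by ring
  have p4 := pow_four_mul_exp_le ht0
  have p1 := mul_exp_le (t := t)
  have p0 : Real.exp (-(2 * t)) ≤ Real.exp (-t) := by rw [Real.exp_le_exp]; linarith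
  have q2 : (2 * ((K : ℝ) * ((K ^ 3 : ℕ) + 1) + 1) + 1) * (1 / 2) ^ (K + 1) ≤
      (2 * ((K : ℝ) * ((K ^ 3 : ℕ) + 1) + 1) + 1) * Real.exp (-(2 * t)) :=
    mul_le_mul_of_nonneg_left h2 (by positivity)
  have q3 : (K : ℝ) * (2 * Real.exp (-(((K ^ 3 : ℕ) : ℝ) / (8 * ((K : ℝ) + 1) ^ 2)))) ≤
      K * (2 * Real.exp (-(2 * t))) := by gcongr
  have r2 : (2 * ((K : ℝ) * ((K ^ 3 : ℕ) + 1) + 1) + 1) * Real.exp (-(2 * t)) =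
      2 * 64 ^ 4 * (t ^ 4 * Real.exp (-(2 * t))) + 128 * (t * Real.exp (-(2 * t))) +
        3 * Real.exp (-(2 * t)) := by
    push_cast; rw [hKt]; ring
  have r3 : (K : ℝ) * (2 * Real.exp (-(2 * t))) = 128 * (t * Real.exp (-(2 * t))) := by
    rw [hKt]; ring
  have hpos := Real.exp_pos (-t)
  have hb' : P.real {ω | RightExit (boxWidth K) (environment U V ω)} ≤ _ := hb
  linarith

end Law

/-! ### Symmetries, norms and attainment of the maximum -/

theorem diagonalWalk_reflect (u v : ℤ → ℤ) (k : ℕ) :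
    diagonalWalk (fun y => -(u y)) (fun x => v (-x)) k =
      (-(diagonalWalk u v k).1, (diagonalWalk u v k).2) := by
  induction k with
  | zero => simp [diagonalWalk]
  | succ k ih =>
    simp only [diagonalWalk, ih, neg_neg, Prod.mk.injEq, and_true]
    ring

theorem diagonalWalk_swap (u v : ℤ → ℤ) (k : ℕ) :
    diagonalWalk v u k = ((diagonalWalk u v k).2, (diagonalWalk u v k).1) := by
  induction k with
  | zero => rfl
  | succ k ih => simp only [diagonalWalk, ih]

theorem latticeNorm_le_of_abs_le {z : ℤ × ℤ} {m n : ℕ} (hmn : 2 * m ≤ n) (h1 : |z.1| ≤ m)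
    (h2 : |z.2| ≤ m) : latticeNorm z ≤ n := by
  have hm : (2 * m : ℝ) ≤ n := by exact_mod_cast hmn
  have a1 : |(z.1 : ℝ)| ≤ m := by exact_mod_cast h1
  have a2 : |(z.2 : ℝ)| ≤ m := by exact_mod_cast h2
  have s1 := sq_le_sq' (abs_le.1 a1).1 (abs_le.1 a1).2
  have s2 := sq_le_sq' (abs_le.1 a2).1 (abs_le.1 a2).2
  have m0 : (0 : ℝ) ≤ m := Nat.cast_nonneg m
  rw [latticeNorm, Real.sqrt_le_left (Nat.cast_nonneg n)]
  nlinarith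

theorem abs_fst_le_latticeNorm (z : ℤ × ℤ) : |(z.1 : ℝ)| ≤ latticeNorm z :=
  Real.abs_le_sqrt (by nlinarith [sq_nonneg (z.2 : ℝ)])

theorem abs_snd_le_latticeNorm (z : ℤ × ℤ) : |(z.2 : ℝ)| ≤ latticeNorm z :=
  Real.abs_le_sqrt (by nlinarith [sq_nonneg (z.1 : ℝ)])

/-- A bounded path attains its maximal distance. -/
theorem exists_maximalDistance_eq {u v : ℤ → ℤ} (h : maximalDistance u v ≠ ∞) :
    ∃ i, maximalDistance u v = ENNReal.ofReal (latticeNorm (diagonalWalk u v i)) := by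
  set B := (maximalDistance u v).toReal with hB
  have hle : ∀ i, latticeNorm (diagonalWalk u v i) ≤ B := by
    intro i
    refine (ENNReal.ofReal_le_iff_le_toReal h).1 ?_
    exact le_iSup (fun i => ENNReal.ofReal (latticeNorm (diagonalWalk u v i))) i
  -- A bounded path visits finitely many lattice points, so the supremum is over a finite set of
  -- values.
  have hfin : (Set.range fun i => diagonalWalk u v i).Finite := by
    refine ((Set.finite_Icc (-⌈B⌉) ⌈B⌉).prod (Set.finite_Icc (-⌈B⌉) ⌈B⌉)).subset ?_
    rintro _ ⟨i, rfl⟩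
    have key : ∀ z : ℤ, |(z : ℝ)| ≤ B → z ∈ Set.Icc (-⌈B⌉) ⌈B⌉ := by
      intro z hz
      have h1 : |(z : ℝ)| ≤ ⌈B⌉ := hz.trans (Int.le_ceil B)
      have h2 : |z| ≤ ⌈B⌉ := by exact_mod_cast h1
      exact abs_le.1 h2
    exact ⟨key _ ((abs_fst_le_latticeNorm _).trans (hle i)),
      key _ ((abs_snd_le_latticeNorm _).trans (hle i))⟩
  have hfin2 : (Set.range fun i => ENNReal.ofReal (latticeNorm (diagonalWalk u v i))).Finite := by
    have := hfin.image fun z => ENNReal.ofReal (latticeNorm z)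
    rwa [← Set.range_comp] at this
  obtain ⟨i, hi⟩ := (Set.range_nonempty _).csSup_mem hfin2
  exact ⟨i, hi.symm⟩

theorem exists_lt_of_lt_maximalDistance {u v : ℤ → ℤ} {n : ℕ}
    (h : (n : ℝ≥0∞) < maximalDistance u v) : ∃ k, (n : ℝ) < latticeNorm (diagonalWalk u v k) := by
  obtain ⟨k, hk⟩ := lt_iSup_iff.1 h
  refine ⟨k, ?_⟩
  rw [← ENNReal.ofReal_natCast] at hk
  exact (ENNReal.ofReal_lt_ofReal_iff_of_nonneg (Nat.cast_nonneg n)).1 hk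

theorem walk_environment {Ω : Type*} (U V : ℤ → Ω → ℤ) (ω : Ω) (k : ℕ) :
    walk (environment U V ω) k = diagonalWalk (fun y => U y ω) (fun x => V x ω) k := rfl

/-! ### The upper tail -/

section Law

variable {Ω : Type*} [MeasurableSpace Ω] {P : Measure Ω} {U V : ℤ → Ω → ℤ}

/-- At the first time a coordinate reaches absolute value `m`, unit steps force equality, and the
path has stayed in the closed box. The four sides become right exits after reflection or exchange of
the axes. -/
theorem IsRandomOrientation.exists_rightExit (h : IsRandomOrientation P U V) {m n : ℕ}
    (hm : 0 < m) (hmn : 2 * m ≤ n) (ω : Ω)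
    (hω : (n : ℝ≥0∞) < maximalDistance (fun y => U y ω) (fun x => V x ω)) :
    RightExit m (environment U V ω) ∨
      RightExit m (environment (fun y ω => -(U y ω)) (fun x => V (-x)) ω) ∨
      RightExit m (environment V U ω) ∨
      RightExit m (environment (fun y ω => -(V y ω)) (fun x => U (-x)) ω) := by
  classical
  simp only [RightExit, walk_environment]
  have e1 := diagonalWalk_reflect (fun y => U y ω) (fun x => V x ω)
  have e2 := diagonalWalk_swap (fun y => U y ω) (fun x => V x ω)
  have e3 := diagonalWalk_reflect (fun y => V y ω) (fun x => U x ω)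
  simp only [e1, e3, e2]
  obtain ⟨k₀, hk₀⟩ := exists_lt_of_lt_maximalDistance hω
  set Z := diagonalWalk (fun y => U y ω) (fun x => V x ω) with hZ
  have hex : ∃ k, (m : ℤ) ≤ |(Z k).1| ∨ (m : ℤ) ≤ |(Z k).2| := by
    refine ⟨k₀, ?_⟩
    by_contra! hcon
    exact absurd hk₀ (not_lt.2 (latticeNorm_le_of_abs_le hmn hcon.1.le hcon.2.le))
  obtain ⟨k, hk, hmin⟩ : ∃ k, ((m : ℤ) ≤ |(Z k).1| ∨ (m : ℤ) ≤ |(Z k).2|) ∧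
      ∀ j < k, |(Z j).1| < m ∧ |(Z j).2| < m :=
    ⟨Nat.find hex, Nat.find_spec hex, fun j hj => by simpa using Nat.find_min hex hj⟩
  have hbound : |(Z k).1| ≤ m ∧ |(Z k).2| ≤ m := by
    rcases k with _ | k
    · simp [hZ, diagonalWalk]
    · obtain ⟨h1, h2⟩ := hmin k (Nat.lt_succ_self k)
      have hu := h.values_U (Z k).2 ω
      have hv := h.values_V (Z k).1 ω
      have s1 : (Z (k + 1)).1 = (Z k).1 + U (Z k).2 ω := rfl
      have s2 : (Z (k + 1)).2 = (Z k).2 + V (Z k).1 ω := rfl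
      rw [s1, s2]
      rw [abs_lt] at h1 h2
      rw [abs_le, abs_le]
      omega
  have hall : ∀ j ≤ k, |(Z j).1| ≤ m ∧ |(Z j).2| ≤ m := by
    intro j hj
    rcases hj.lt_or_eq with hj | rfl
    · exact ⟨(hmin j hj).1.le, (hmin j hj).2.le⟩
    · exact hbound
  rcases hk with hk | hk
  · rcases abs_eq (by positivity : (0 : ℤ) ≤ m) |>.1 (le_antisymm hbound.1 hk) with h1 | h1
    · exact Or.inl ⟨k, h1, fun j hj => (hall j hj).2⟩
    · exact Or.inr (Or.inl ⟨k, by simp [h1], fun j hj => (hall j hj).2⟩)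
  · rcases abs_eq (by positivity : (0 : ℤ) ≤ m) |>.1 (le_antisymm hbound.2 hk) with h1 | h1
    · exact Or.inr (Or.inr (Or.inl ⟨k, h1, fun j hj => (hall j hj).1⟩))
    · exact Or.inr (Or.inr (Or.inr ⟨k, by simp [h1], fun j hj => (hall j hj).1⟩))

theorem IsRandomOrientation.real_lt_maximalDistance_le [IsProbabilityMeasure P]
    (h : IsRandomOrientation P U V) {K n : ℕ} (hn : 2 * boxWidth K ≤ n) :
    P.real {ω | (n : ℝ≥0∞) < maximalDistance (fun y => U y ω) (fun x => V x ω)} ≤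
      4 * 10 ^ 9 * Real.exp (-(K / 64)) := by
  have hsub := measureReal_mono (μ := P) fun ω hω =>
    h.exists_rightExit (Nat.succ_pos _) hn ω hω
  have b1 := h.real_rightExit_boxWidth_le K
  have b2 := h.reflect.real_rightExit_boxWidth_le K
  have b3 := h.swap.real_rightExit_boxWidth_le K
  have b4 := h.swap.reflect.real_rightExit_boxWidth_le K
  refine (hsub.trans (measureReal_union_le _ _)).trans ?_
  refine (add_le_add_right (measureReal_union_le _ _) _).trans ?_
  refine (add_le_add_right (add_le_add_right (measureReal_union_le _ _) _) _).trans ?_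
  refine (add_le_add b1 (add_le_add b2 (add_le_add b3 b4))).trans_eq ?_
  ring

/-- The upper tail bound. -/
theorem IsRandomOrientation.tail_le [IsProbabilityMeasure P]
    (h : IsRandomOrientation P U V) (n : ℕ) :
    P.real {ω | (n : ℝ≥0∞) < maximalDistance (fun y => U y ω) (fun x => V x ω)} ≤
      8 * 10 ^ 9 * Real.exp (-(1 / 128) * (n : ℝ) ^ ((1 : ℝ) / 4)) := by
  set r : ℝ := (n : ℝ) ^ ((1 : ℝ) / 4) with hr
  have hr0 : 0 ≤ r := by positivity
  have hr4 : r ^ 4 = n := by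
    rw [hr, ← Real.rpow_natCast, ← Real.rpow_mul (Nat.cast_nonneg n)]
    norm_num
  -- Then 16 K^4 ≤ n, which leaves room for 2(K^4 + K + 1) when K ≥ 1; for K = 0 the bound exceeds
  -- 1.
  set K := ⌊r / 2⌋₊ with hK
  have hK1 : (K : ℝ) ≤ r / 2 := Nat.floor_le (by positivity)
  have hK2 : r / 2 < K + 1 := Nat.lt_floor_add_one _
  have hmain : P.real {ω | (n : ℝ≥0∞) < maximalDistance (fun y => U y ω) (fun x => V x ω)} ≤
      4 * 10 ^ 9 * Real.exp (-(K / 64)) := by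
    rcases Nat.eq_zero_or_pos K with h0 | h0
    · rw [h0]
      refine measureReal_le_one.trans ?_
      norm_num
    · refine h.real_lt_maximalDistance_le ?_
      have h1 : (K : ℝ) ^ 4 ≤ (r / 2) ^ 4 := pow_le_pow_left₀ (Nat.cast_nonneg K) hK1 4
      have h2 : (16 * K ^ 4 : ℝ) ≤ n := by rw [div_pow, hr4] at h1; linarith
      have h3 : 16 * K ^ 4 ≤ n := by exact_mod_cast h2
      have h4 : K ≤ K ^ 4 := Nat.le_self_pow (by norm_num) K
      have h5 : boxWidth K = K ^ 4 + K + 1 := by rw [boxWidth]; ring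
      omega
  refine hmain.trans ?_
  -- Rounding down costs at most exp(1/64) ≤ 2.
  have h6 : Real.exp (-(K / 64 : ℝ)) ≤ 2 * Real.exp (-(1 / 128) * r) := by
    have h7 : Real.exp (1 / 64) ≤ 2 := by
      have h8 := Real.add_one_le_exp (-(1 / 64) : ℝ)
      rw [Real.exp_neg] at h8
      have h9 : (1 : ℝ) / 2 ≤ (Real.exp (1 / 64))⁻¹ := by linarith
      rw [one_div] at h9
      exact (inv_le_inv₀ (by norm_num) (Real.exp_pos _)).1 h9
    calc Real.exp (-(K / 64 : ℝ)) ≤ Real.exp (1 / 64 + -(1 / 128) * r) := by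
          rw [Real.exp_le_exp]; linarith
      _ = Real.exp (1 / 64) * Real.exp (-(1 / 128) * r) := Real.exp_add _ _
      _ ≤ _ := mul_le_mul_of_nonneg_right h7 (Real.exp_pos _).le
  linarith

/-! ### The lower tail -/

/-- Inside the strip every horizontal line points right, so vertical lines are used in order.
Confinement up to time n allows one more step, to abscissa n+1 > n. -/
theorem walk_eq_of_isRun_confined {c : Environment} {L n : ℕ}
    (h1 : IsRun (-L) (2 * L + 1) c) (h2 : Confined L 0 n c) {k : ℕ} (hk : k ≤ n + 1) :
    walk c k = ((k : ℤ), partialSum c 0 k) := by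
  induction k with
  | zero => simp [walk_zero, partialSum]
  | succ k ih =>
    have hw := ih (by omega)
    have hb := abs_le.1 (h2 k (by omega))
    have hu := h1 (partialSum c 0 k + L).toNat (by omega)
    rw [show -(L : ℤ) + ((partialSum c 0 k + L).toNat : ℕ) = partialSum c 0 k by omega] at hu
    rw [walk_succ, hw, partialSum_succ]
    simp [hu]

/-- The lower tail bound. -/
theorem IsRandomOrientation.le_tail [IsProbabilityMeasure P]
    (h : IsRandomOrientation P U V) (n : ℕ) :
    Real.exp (-3) * Real.exp (-5 * (n : ℝ) ^ ((1 : ℝ) / 3)) ≤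
      P.real {ω | (n : ℝ≥0∞) < maximalDistance (fun y => U y ω) (fun x => V x ω)} := by
  set r : ℝ := (n : ℝ) ^ ((1 : ℝ) / 3) with hr
  have hr0 : 0 ≤ r := by positivity
  have hr3 : r ^ 3 = n := by
    rw [hr, ← Real.rpow_natCast, ← Real.rpow_mul (Nat.cast_nonneg n)]
    norm_num
  set L := ⌊r⌋₊ + 1 with hL
  have hL1 : (L : ℝ) ≤ r + 1 := by
    rw [hL]; push_cast; linarith [Nat.floor_le hr0]
  have hL2 : r ≤ L := by
    rw [hL]; push_cast; exact (Nat.lt_floor_add_one r).le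
  have hL3 : (1 : ℝ) ≤ L := by rw [hL]; push_cast; linarith [(Nat.cast_nonneg ⌊r⌋₊ : (0 : ℝ) ≤ _)]
  have hsub : P.real {ω | IsRun (-L) (2 * L + 1) (environment U V ω) ∧
        Confined L 0 n (environment U V ω)} ≤
      P.real {ω | (n : ℝ≥0∞) < maximalDistance (fun y => U y ω) (fun x => V x ω)} := by
    refine measureReal_mono ?_
    rintro ω ⟨h1, h2⟩
    have hw := walk_eq_of_isRun_confined h1 h2 (le_refl (n + 1))
    refine lt_of_lt_of_le ?_ (le_iSup (fun i => ENNReal.ofReal (latticeNorm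
      (diagonalWalk (fun y => U y ω) (fun x => V x ω) i))) (n + 1))
    rw [← walk_environment, hw, ← ENNReal.ofReal_natCast,
      ENNReal.ofReal_lt_ofReal_iff_of_nonneg (Nat.cast_nonneg n)]
    refine lt_of_lt_of_le ?_ (abs_fst_le_latticeNorm _)
    refine lt_of_lt_of_le ?_ (le_abs_self _)
    push_cast
    linarith
  refine le_trans ?_ ((h.le_real_isRun_confined L n).trans hsub)
  set t : ℝ := (Real.pi / (2 * ((L : ℝ) + 1))) ^ 2 / 2 with ht
  have ht0 : 0 ≤ t := by positivity
  have hpi : Real.pi ^ 2 ≤ 10 := by nlinarith [Real.pi_lt_d2, Real.pi_pos]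
  have ht1 : t * (L + 1) ^ 2 ≤ 5 / 4 := by
    have : t * (L + 1) ^ 2 = Real.pi ^ 2 / 8 := by rw [ht]; field_simp; norm_num
    linarith
  have ht2 : t ≤ 1 / 2 := by nlinarith
  -- cos θ ≥ 1 - t ≥ 1/(1 + 2t) ≥ exp(-2t), the middle inequality requiring t ≤ 1/2.
  have hcos : Real.exp (-(2 * t)) ≤ Real.cos (Real.pi / (2 * ((L : ℝ) + 1))) := by
    refine le_trans ?_ (Real.one_sub_sq_div_two_le_cos)
    rw [← ht, Real.exp_neg, inv_le_comm₀ (Real.exp_pos _) (by linarith)]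
    refine le_trans ?_ (Real.add_one_le_exp _)
    rw [inv_le_iff_one_le_mul₀ (by linarith)]
    nlinarith
  have hpow := pow_le_pow_left₀ (Real.exp_pos _).le hcos n
  rw [← Real.exp_nat_mul] at hpow
  have hhalf : Real.exp (-(2 * L + 1)) ≤ (1 / 2) ^ (2 * L + 1) := by
    have h1 : Real.exp (-1) ≤ 1 / 2 := by
      rw [Real.exp_neg, one_div]
      exact inv_anti₀ (by norm_num) (by linarith [Real.add_one_le_exp (1 : ℝ)])
    have h2 := pow_le_pow_left₀ (Real.exp_pos _).le h1 (2 * L + 1)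
    rw [← Real.exp_nat_mul] at h2
    refine le_trans (le_of_eq ?_) h2
    congr 1; push_cast; ring
  refine le_trans ?_ (mul_le_mul hpow hhalf (Real.exp_pos _).le
    (pow_nonneg ((Real.exp_pos _).le.trans hcos) n))
  rw [← Real.exp_add, ← Real.exp_add, Real.exp_le_exp]
  -- The total exponent 2nt + 2L + 1 is then at most (9/2) r + 3, within 5r + 3.
  have hnt : n * t ≤ 5 / 4 * r := by
    have h1 : r ^ 2 ≤ (L + 1 : ℝ) ^ 2 := pow_le_pow_left₀ hr0 (by linarith) 2
    calc n * t = r * (t * r ^ 2) := by rw [← hr3]; ring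
      _ ≤ r * (t * (L + 1) ^ 2) := by gcongr
      _ ≤ r * (5 / 4) := by gcongr
      _ = 5 / 4 * r := by ring
  linarith

/-! ### Almost sure finiteness and conclusion -/

/-- An unbounded path lies in every tail event, and the upper tail bound tends to 0. -/
theorem IsRandomOrientation.ae_maximalDistance_ne_top [IsProbabilityMeasure P]
    (h : IsRandomOrientation P U V) :
    ∀ᵐ ω ∂P, maximalDistance (fun y => U y ω) (fun x => V x ω) ≠ ∞ := by
  rw [ae_iff]
  simp only [ne_eq, not_not]
  rw [← measureReal_eq_zero_iff]
  have hlim : Filter.Tendsto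
      (fun n : ℕ => 8 * 10 ^ 9 * Real.exp (-(1 / 128) * (n : ℝ) ^ ((1 : ℝ) / 4)))
      Filter.atTop (nhds (8 * 10 ^ 9 * 0)) := by
    refine Filter.Tendsto.const_mul _ (Real.tendsto_exp_atBot.comp ?_)
    refine Filter.Tendsto.const_mul_atTop_of_neg (by norm_num) ?_
    exact (tendsto_rpow_atTop (by norm_num)).comp tendsto_natCast_atTop_atTop
  rw [mul_zero] at hlim
  refine le_antisymm (ge_of_tendsto' hlim fun n => ?_) measureReal_nonneg
  refine (measureReal_mono ?_).trans (h.tail_le n)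
  intro ω hω
  show (n : ℝ≥0∞) < _
  rw [show maximalDistance (fun y => U y ω) (fun x => V x ω) = ∞ from hω]
  exact ENNReal.natCast_lt_top n

end Law

/-- There are absolute positive constants such that, in every realization of the model, the
maximal distance reached by the path is almost surely a maximum, and its tail obeys the two
stretched-exponential bounds. -/
theorem mainTheorem7 :
    ∃ c₁ C₁ c₂ C₂ : ℝ, 0 < c₁ ∧ 0 < C₁ ∧ 0 < c₂ ∧ 0 < C₂ ∧
      ∀ (Ω : Type*) [MeasurableSpace Ω] (P : Measure Ω) [IsProbabilityMeasure P]
        (U V : ℤ → Ω → ℤ), IsRandomOrientation P U V →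
        (∀ᵐ ω ∂P, ∃ i : ℕ,
          maximalDistance (fun y => U y ω) (fun x => V x ω) =
            ENNReal.ofReal
              (latticeNorm (diagonalWalk (fun y => U y ω) (fun x => V x ω) i))) ∧
        ∀ n : ℕ,
          C₁ * Real.exp (-c₁ * (n : ℝ) ^ ((1 : ℝ) / 3)) ≤
              P.real {ω | (n : ℝ≥0∞) <
                maximalDistance (fun y => U y ω) (fun x => V x ω)} ∧
            P.real {ω | (n : ℝ≥0∞) <
                maximalDistance (fun y => U y ω) (fun x => V x ω)} ≤
              C₂ * Real.exp (-c₂ * (n : ℝ) ^ ((1 : ℝ) / 4)) := by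
  refine ⟨5, Real.exp (-3), 1 / 128, 8 * 10 ^ 9, by norm_num, Real.exp_pos _, by norm_num,
    by norm_num, fun Ω _ P _ U V h => ⟨?_, fun n => ⟨h.le_tail n, h.tail_le n⟩⟩⟩
  filter_upwards [h.ae_maximalDistance_ne_top] with ω hω
  exact exists_maximalDistance_eq hω
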